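/- Let $M\le N$ be nonnegative integers and let $\Sigma$ be an $M\times M$ Hermitian positive definite complex matrix. Let $\mathbf X$ be a random $M\times N$ complex matrix whose $N$ columns are independent, each being a zero-mean circularly symmetric complex Gaussian random vector $x$ in $\mathbb C^M$ with covariance matrix $\Sigma$; that is, the real and imaginary parts of the entries of $x$ are jointly Gaussian, $\mathbb E[x]=0$, $\mathbb E[xx^\dagger]=\Sigma$ and $\mathbb E[xx^{T}]=0$. (In particular, if $\Sigma$ has unit diagonal, every entry of $\mathbf X$ has zero mean and unit variance.) Then $\det(\mathbf X\mathbf X^\dagger)>0$ almost surely, $\ln\det(\mathbf X\mathbf X^\dagger)$ is square integrable, and its mean and variance are $$\mathbb E\left[\ln\det(\mathbf X\mathbf X^\dagger)\right]=\sum_{m=0}^{M-1}\psi(N-m)+\ln\det\Sigma,$$ $$\operatorname{Var}\left[\ln\det(\mathbf X\mathbf X^\dagger)\right]=\sum_{m=0}^{M-1}\zeta(2,N-m),$$ where $\psi=\Gamma'/\Gamma$ is the digamma function and $\zeta(z,q)=\sum_{k=0}^{\infty}\frac{1}{(q+k)^z}$. -/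

import Mathlib

open MeasureTheory ProbabilityTheory
open scoped Matrix ComplexOrder ComplexConjugate

/-- The generalized (Hurwitz) zeta function `ζ(z, q) = ∑_{k ≥ 0} 1 / (q + k) ^ z`
for real `z > 1` and `q > 0`. -/
noncomputable def hurwitzZetaSeries (z q : ℝ) : ℝ :=
  ∑' k : ℕ, 1 / (q + k) ^ z

/-- The random vector `x` in `ℂᴹ` is a zero-mean circularly symmetric complex Gaussian vector with
covariance matrix `S = 𝔼[x x†]`: it is jointly Gaussian (as a real random vector made of the real
and imaginary parts), has mean zero and covariances `𝔼[xᵢ x̄ⱼ] = Sᵢⱼ`, and its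
pseudo-covariances `𝔼[xᵢ xⱼ]` vanish. -/
structure IsCircularComplexGaussian {Ω : Type*} [MeasurableSpace Ω] {M : ℕ}
    (x : Ω → Fin M → ℂ) (S : Matrix (Fin M) (Fin M) ℂ) (μ : Measure Ω) : Prop where
  hasGaussianLaw : HasGaussianLaw x μ
  mean_eq_zero : ∀ i, ∫ ω, x ω i ∂μ = 0
  covariance_eq : ∀ i j, ∫ ω, x ω i * conj (x ω j) ∂μ = S i j
  pseudoCovariance_eq_zero : ∀ i j, ∫ ω, x ω i * x ω j ∂μ = 0

/-- `ln det (A A†)`. The determinant of `A A†` is a nonnegative real number, so taking its real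
part loses nothing. -/
noncomputable def logDetGram {M N : ℕ} (A : Matrix (Fin M) (Fin N) ℂ) : ℝ :=
  Real.log (A * Aᴴ).det.re

/-! Choose `B` with `B * S * Bᴴ = 1`. The columns of `B * X` are then independent standard complex
Gaussians, so by symmetry its rows are also independent isotropic Gaussians in ℂᴺ, and `det (X Xᴴ)`
is `det S` times the Gram determinant of these rows.

A Gram determinant is "base times height": adding a row to `m` independent ones multiplies it by the
squared norm of the projection of the new row onto an `(N - m)`-dimensional orthogonal complement.
That projection is again isotropic Gaussian, with `s`-th moment `Γ(N-m+s)/Γ(N-m)` of its squared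
norm. Induction (`lintegral_det_gram_rpow`) gives all moments for `s > -1`, and `moment_logDetGram`
reads them as the moment generating function of the log-determinant.

Near `0` the cumulant generating function is therefore `s * log det S` plus a sum of differences of
`log Γ`. Its first two derivatives at `0` are the mean and the variance. The second derivative of
`log Γ` at integers follows from the reflection formula and the recursion of `Γ`. -/

/-! ### Isotropic Gaussian measures: projections and radial moments. -/

section IsotropicGaussian

variable {V : Type*} [NormedAddCommGroup V] [InnerProductSpace ℝ V] [FiniteDimensional ℝ V]
  [MeasurableSpace V] [BorelSpace V]

/-- The centred isotropic Gaussian measure on a Euclidean space whose density with respect to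
the Lebesgue measure is `π ^ (-dim V / 2) * exp (-‖x‖ ^ 2)`. -/
noncomputable def isotropicGaussian (V : Type*) [NormedAddCommGroup V] [InnerProductSpace ℝ V]
    [FiniteDimensional ℝ V] [MeasurableSpace V] [BorelSpace V] : Measure V :=
  volume.withDensity fun x =>
    ENNReal.ofReal ((Real.pi ^ (Module.finrank ℝ V / 2 : ℝ))⁻¹ * Real.exp (-‖x‖ ^ 2))

theorem integrable_exp_neg_norm_sq :
    Integrable (fun x : V => Real.exp (-‖x‖ ^ 2)) := by
  have h := GaussianFourier.integrable_cexp_neg_mul_sq_norm_add (V := V) (b := 1) (by simp) 0 0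
  refine h.norm.congr (.of_forall fun x => ?_)
  simp only [Complex.norm_exp]
  congr 1
  norm_cast
  simp

theorem integral_exp_neg_norm_sq :
    ∫ x : V, Real.exp (-‖x‖ ^ 2) = Real.pi ^ (Module.finrank ℝ V / 2 : ℝ) := by
  simpa using GaussianFourier.integral_rexp_neg_mul_sq_norm (V := V) (b := 1) one_pos

theorem lintegral_isotropicGaussian {f : V → ENNReal} (hf : Measurable f) :
    ∫⁻ x, f x ∂(isotropicGaussian V) =
      ∫⁻ x, ENNReal.ofReal ((Real.pi ^ (Module.finrank ℝ V / 2 : ℝ))⁻¹ * Real.exp (-‖x‖ ^ 2))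
        * f x := by
  rw [isotropicGaussian, lintegral_withDensity_eq_lintegral_mul _ (by fun_prop) hf]
  rfl

instance isProbabilityMeasure_isotropicGaussian :
    IsProbabilityMeasure (isotropicGaussian V) := by
  constructor
  rw [isotropicGaussian, withDensity_apply _ MeasurableSet.univ, Measure.restrict_univ,
    ← ofReal_integral_eq_lintegral_ofReal (integrable_exp_neg_norm_sq.const_mul _)
      (.of_forall fun x => by positivity), integral_const_mul, integral_exp_neg_norm_sq,
    inv_mul_cancel₀ (by positivity), ENNReal.ofReal_one]

theorem charFun_isotropicGaussian (t : V) :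
    charFun (isotropicGaussian V) t = Complex.exp (-(‖t‖ ^ 2 / 4 : ℝ)) := by
  rw [charFun_apply, isotropicGaussian, integral_withDensity_eq_integral_toReal_smul₀ (by fun_prop)
    (.of_forall fun x => ENNReal.ofReal_lt_top)]
  have h := GaussianFourier.integral_cexp_neg_mul_sq_norm_add (V := V) (b := 1) (by simp)
    Complex.I t
  have hpi : ((Real.pi : ℂ) ^ (Module.finrank ℝ V / 2 : ℂ)) =
      ((Real.pi ^ (Module.finrank ℝ V / 2 : ℝ) : ℝ) : ℂ) := by
    rw [Complex.ofReal_cpow Real.pi_pos.le]; simp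
  have hpos : (0 : ℝ) < Real.pi ^ (Module.finrank ℝ V / 2 : ℝ) := by positivity
  calc _ = ∫ x : V, ((Real.pi ^ (Module.finrank ℝ V / 2 : ℝ) : ℝ) : ℂ)⁻¹ *
        Complex.exp (-1 * ‖x‖ ^ 2 + Complex.I * inner ℝ t x) := by
        refine integral_congr_ae (.of_forall fun x => ?_)
        simp only
        rw [ENNReal.toReal_ofReal (by positivity), Complex.real_smul, Complex.exp_add,
          real_inner_comm]
        push_cast
        rw [mul_assoc, mul_comm Complex.I]
        simp
    _ = _ := by
        rw [integral_const_mul, h, div_one, hpi, ← mul_assoc, inv_mul_cancel₀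
          (by exact_mod_cast hpos.ne'), one_mul]
        congr 1
        push_cast
        rw [Complex.I_sq]
        ring

/-- The characteristic function depends only on the norm, and the adjoint `i` of `L` preserves
norms. This covers orthogonal projections written in orthonormal coordinates. -/
theorem isotropicGaussian_map_of_adjoint_isometry {U : Type*} [NormedAddCommGroup U]
    [InnerProductSpace ℝ U] [FiniteDimensional ℝ U] [MeasurableSpace U] [BorelSpace U]
    (L : V →L[ℝ] U) (i : U → V) (hL : ∀ x t, inner ℝ (L x) t = inner ℝ x (i t))
    (hi : ∀ t, ‖i t‖ = ‖t‖) :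
    (isotropicGaussian V).map L = isotropicGaussian U := by
  have : IsProbabilityMeasure ((isotropicGaussian V).map L) :=
    Measure.isProbabilityMeasure_map (by fun_prop)
  refine Measure.ext_of_charFun (funext fun t => ?_)
  rw [charFun_isotropicGaussian, charFun_apply, integral_map (by fun_prop) (by fun_prop), ← hi t,
    ← charFun_isotropicGaussian, charFun_apply]
  simp_rw [hL]

theorem integral_norm_rpow_mul_exp_neg_norm_sq [Nontrivial V] {q : ℝ}
    (hq : 0 < Module.finrank ℝ V + q) :
    Integrable (fun x : V => ‖x‖ ^ q * Real.exp (-‖x‖ ^ 2)) ∧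
    ∫ x : V, ‖x‖ ^ q * Real.exp (-‖x‖ ^ 2) =
      (Module.finrank ℝ V * volume.real (Metric.ball (0 : V) 1) / 2) *
        Real.Gamma ((Module.finrank ℝ V + q) / 2) := by
  have hd : 0 < Module.finrank ℝ V := Module.finrank_pos
  have heq : ∀ y ∈ Set.Ioi (0 : ℝ),
      y ^ (Module.finrank ℝ V + q - 1) * Real.exp (-y ^ (2 : ℝ)) =
      y ^ (Module.finrank ℝ V - 1) • (y ^ q * Real.exp (-y ^ 2)) := by
    intro y hy
    rw [smul_eq_mul, ← mul_assoc, ← Real.rpow_natCast y (Module.finrank ℝ V - 1),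
      ← Real.rpow_add hy, Nat.cast_sub hd]
    norm_cast
    congr 2
    push_cast; ring
  constructor
  · rw [integrable_fun_norm_addHaar volume (f := fun y : ℝ => y ^ q * Real.exp (-y ^ 2))]
    refine (integrableOn_rpow_mul_exp_neg_rpow (s := Module.finrank ℝ V + q - 1) (p := 2)
      (by linarith) (by norm_num)).congr_fun heq measurableSet_Ioi
  · rw [integral_fun_norm_addHaar volume (fun y : ℝ => y ^ q * Real.exp (-y ^ 2)),
      ← setIntegral_congr_fun measurableSet_Ioi heq,
      integral_rpow_mul_exp_neg_rpow (by norm_num) (by linarith)]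
    simp only [nsmul_eq_mul, smul_eq_mul]
    rw [show (Module.finrank ℝ V + q - 1 + 1) = Module.finrank ℝ V + q by ring]
    ring

theorem lintegral_norm_sq_rpow_isotropicGaussian [Nontrivial V] {s : ℝ}
    (hs : 0 < Module.finrank ℝ V / 2 + s) :
    ∫⁻ x, ENNReal.ofReal (‖x‖ ^ 2) ^ s ∂(isotropicGaussian V) =
      ENNReal.ofReal (Real.Gamma (Module.finrank ℝ V / 2 + s) /
        Real.Gamma (Module.finrank ℝ V / 2)) := by
  have hd : (0 : ℝ) < Module.finrank ℝ V := by exact_mod_cast Module.finrank_pos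
  obtain ⟨hint, hval⟩ := integral_norm_rpow_mul_exp_neg_norm_sq (V := V) (q := 2 * s) (by linarith)
  -- The case `q = 0` computes the total mass a second time, so the volume of the unit ball cancels
  -- without being evaluated.
  obtain ⟨-, hone⟩ := integral_norm_rpow_mul_exp_neg_norm_sq (V := V) (q := 0) (by linarith)
  simp only [Real.rpow_zero, one_mul, integral_exp_neg_norm_sq, add_zero] at hone
  rw [lintegral_isotropicGaussian (by fun_prop)]
  have hpos : (0 : ℝ) < Real.pi ^ (Module.finrank ℝ V / 2 : ℝ) := by positivity
  calc _ = ∫⁻ x : V, ENNReal.ofReal ((Real.pi ^ (Module.finrank ℝ V / 2 : ℝ))⁻¹ *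
        (‖x‖ ^ (2 * s) * Real.exp (-‖x‖ ^ 2))) := by
        refine lintegral_congr_ae ?_
        have : ∀ᵐ x : V, x ≠ 0 := by simp [ae_iff]
        filter_upwards [this] with x hx
        rw [ENNReal.ofReal_rpow_of_pos (by positivity), ← ENNReal.ofReal_mul (by positivity),
          Real.rpow_mul (norm_nonneg _)]
        norm_cast
        congr 1; ring
    _ = _ := by
        rw [← ofReal_integral_eq_lintegral_ofReal (hint.const_mul _)
          (.of_forall fun x => by positivity), integral_const_mul, hval]
        congr 1
        have hG : 0 < Real.Gamma (Module.finrank ℝ V / 2) := Real.Gamma_pos_of_pos (by positivity)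
        rw [show (Module.finrank ℝ V + 2 * s) / 2 = Module.finrank ℝ V / 2 + s by ring]
        rw [hone] at hpos ⊢
        have hc := (pos_iff_pos_of_mul_pos hpos).2 hG
        generalize Module.finrank ℝ V * volume.real (Metric.ball (0 : V) 1) / 2 = c at hc
        field_simp

end IsotropicGaussian

/-! ### Gram determinants: base times height. -/

section Gram

variable {E : Type*} [NormedAddCommGroup E] [InnerProductSpace ℂ E]

theorem gram_sum_smul {m n : Type*} [Fintype n] (A : Matrix m n ℂ) (v : n → E) :
    Matrix.gram ℂ (fun i => ∑ j, A i j • v j) = A.map conj * Matrix.gram ℂ v * Aᵀ := by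
  ext i j
  simp only [Matrix.gram_apply, sum_inner, inner_sum, inner_smul_left, inner_smul_right,
    Matrix.mul_apply, Matrix.map_apply, Matrix.transpose_apply, Finset.sum_mul]
  simp_rw [Finset.mul_sum]
  exact Finset.sum_congr rfl fun _ _ => Finset.sum_congr rfl fun _ _ => by ring

/-- The change of family is given by a unitriangular matrix, which has determinant one. -/
theorem det_gram_cons_add_sum_smul {M : ℕ} (z : E) (v : Fin M → E) (c : Fin M → ℂ) :
    (Matrix.gram ℂ (Fin.cons (z + ∑ j, c j • v j) v : Fin (M + 1) → E)).det =
      (Matrix.gram ℂ (Fin.cons z v : Fin (M + 1) → E)).det := by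
  let A : Matrix (Fin (M + 1)) (Fin (M + 1)) ℂ :=
    Matrix.of (Fin.cons (Fin.cons 1 c) fun i => Pi.single i.succ 1)
  have hA : A.det = 1 := by
    rw [Matrix.det_of_isUpperTriangular]
    · simp [Fin.prod_univ_succ, A]
    · intro i j hij
      refine Fin.cases (fun h => ?_) (fun i h => ?_) i hij
      · exact absurd h (by simp)
      · have : j ≠ i.succ := ne_of_lt h
        simp [A, this]
  have hv : (Fin.cons (z + ∑ j, c j • v j) v : Fin (M + 1) → E) =
      fun i => ∑ j, A i j • (Fin.cons z v : Fin (M + 1) → E) j := by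
    funext i
    refine Fin.cases ?_ (fun i => ?_) i
    · simp [Fin.sum_univ_succ, A]
    · simp [A, Pi.single_apply]
  have hA' : (A.map conj).det = 1 := by
    have := (starRingEnd ℂ).map_det A
    rw [hA, map_one] at this
    exact this.symm
  rw [hv, gram_sum_smul, Matrix.det_mul, Matrix.det_mul, Matrix.det_transpose, hA, hA']
  ring

theorem det_gram_cons_of_orthogonal {M : ℕ} (z : E) (v : Fin M → E)
    (h : ∀ j, inner ℂ z (v j) = 0) :
    (Matrix.gram ℂ (Fin.cons z v : Fin (M + 1) → E)).det =
      (‖z‖ ^ 2 : ℝ) * (Matrix.gram ℂ v).det := by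
  rw [Matrix.det_succ_row_zero, Fin.sum_univ_succ]
  simp only [Matrix.gram_apply, Fin.cons_zero, Fin.cons_succ, h]
  simp only [mul_zero, zero_mul, Finset.sum_const_zero, add_zero, inner_self_eq_norm_sq_to_K]
  simp
  left
  congr 1

theorem det_gram_cons [FiniteDimensional ℂ E] {M : ℕ} (z : E) (v : Fin M → E) :
    (Matrix.gram ℂ (Fin.cons z v : Fin (M + 1) → E)).det =
      (‖(Submodule.span ℂ (Set.range v))ᗮ.orthogonalProjectionOnto z‖ ^ 2 : ℝ) *
        (Matrix.gram ℂ v).det := by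
  set K := Submodule.span ℂ (Set.range v)
  obtain ⟨c, hc⟩ := (Submodule.mem_span_range_iff_exists_fun ℂ).1
    (K.orthogonalProjectionOnto z).2
  have hz : z = (Kᗮ.orthogonalProjectionOnto z : E) + ∑ j, c j • v j := by
    rw [hc, add_comm]
    exact (K.starProjection_add_starProjection_orthogonal z).symm
  conv_lhs => rw [hz]
  rw [det_gram_cons_add_sum_smul, det_gram_cons_of_orthogonal]
  · rfl
  · intro j
    exact Submodule.inner_left_of_mem_orthogonal (K := K)
      (Submodule.subset_span (Set.mem_range_self j))
      (Kᗮ.orthogonalProjectionOnto z).2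

end Gram

/-! ### Moments of the Gram determinant of independent Gaussian vectors. -/

section GramMoments

theorem real_inner_euclideanSpace_complex {ι : Type*} [Fintype ι] (x y : EuclideanSpace ℂ ι) :
    inner ℝ x y = (inner ℂ x y).re := by
  simp [PiLp.inner_apply, Complex.inner]

theorem finrank_real_euclideanSpace_complex (k : ℕ) :
    (Module.finrank ℝ (EuclideanSpace ℂ (Fin k)) / 2 : ℝ) = k := by
  rw [show Module.finrank ℝ (EuclideanSpace ℂ (Fin k)) = 2 * k by
    rw [finrank_real_of_complex, finrank_euclideanSpace_fin]]
  push_cast; ring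

theorem lintegral_norm_sq_orthogonalProjection_rpow {N : ℕ}
    (K : Submodule ℂ (EuclideanSpace ℂ (Fin N))) {k : ℕ}
    (hk : Module.finrank ℂ K = k) (hk0 : 0 < k) {s : ℝ} (hs : 0 < k + s) :
    ∫⁻ z, ENNReal.ofReal (‖K.orthogonalProjectionOnto z‖ ^ 2) ^ s
        ∂(isotropicGaussian (EuclideanSpace ℂ (Fin N))) =
      ENNReal.ofReal (Real.Gamma (k + s) / Real.Gamma k) := by
  let b := (stdOrthonormalBasis ℂ K).reindex (finCongr hk)
  have : NeZero k := ⟨hk0.ne'⟩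
  let L : EuclideanSpace ℂ (Fin N) →L[ℂ] EuclideanSpace ℂ (Fin k) :=
    b.repr.toContinuousLinearEquiv.toContinuousLinearMap ∘L K.orthogonalProjectionOnto
  have hmap := isotropicGaussian_map_of_adjoint_isometry (L.restrictScalars ℝ)
    (fun t => (b.repr.symm t : EuclideanSpace ℂ (Fin N)))
    (fun x t => by
      rw [real_inner_euclideanSpace_complex, real_inner_euclideanSpace_complex]
      simp [L, LinearIsometryEquiv.inner_map_eq_flip])
    (fun t => b.repr.symm.norm_map t)
  have h := lintegral_norm_sq_rpow_isotropicGaussian (V := EuclideanSpace ℂ (Fin k)) (s := s)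
    (by rwa [finrank_real_euclideanSpace_complex])
  rw [finrank_real_euclideanSpace_complex, ← hmap, lintegral_map (by fun_prop) (by fun_prop)] at h
  simpa [L] using h

theorem measurable_det_gram_re {E : Type*} [NormedAddCommGroup E] [InnerProductSpace ℂ E]
    [FiniteDimensional ℂ E] [MeasurableSpace E] [BorelSpace E]
    {n : Type*} [Fintype n] [DecidableEq n] :
    Measurable fun v : n → E => (Matrix.gram ℂ v).det.re := by
  refine Continuous.measurable (Complex.continuous_re.comp (Continuous.matrix_det ?_))
  exact continuous_matrix fun i j => by simp only [Matrix.gram_apply]; fun_prop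

/-- In `ENNReal`, `0 ^ s = ⊤` for `s < 0`, so a finite negative moment forces the base to be nonzero
almost everywhere. -/
theorem ae_det_gram_re_pos_of_lintegral_ne_top {E : Type*} [NormedAddCommGroup E]
    [InnerProductSpace ℂ E] [FiniteDimensional ℂ E] [MeasurableSpace E] [BorelSpace E]
    {n : Type*} [Fintype n] [DecidableEq n]
    {μ : Measure (n → E)} {s : ℝ} (hs : s < 0)
    (h : ∫⁻ v, ENNReal.ofReal (Matrix.gram ℂ v).det.re ^ s ∂μ ≠ ⊤) :
    ∀ᵐ v ∂μ, 0 < (Matrix.gram ℂ v).det.re := by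
  filter_upwards [ae_lt_top (measurable_det_gram_re.ennreal_ofReal.pow_const s) h] with v hv
  by_contra hle
  rw [ENNReal.ofReal_of_nonpos (not_lt.1 hle), ENNReal.zero_rpow_of_neg hs] at hv
  exact lt_irrefl _ hv

/-- Induction on `M`, integrating out the new vector with the others fixed. The bound `-1 < s` keeps
every Gamma argument positive, since `N - m ≥ 1`. -/
theorem lintegral_det_gram_rpow (N M : ℕ) (hMN : M ≤ N)
    {s : ℝ} (hs : -1 < s) :
    ∫⁻ v, ENNReal.ofReal (Matrix.gram ℂ v).det.re ^ s
        ∂(Measure.pi fun _ : Fin M => isotropicGaussian (EuclideanSpace ℂ (Fin N))) =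
      ENNReal.ofReal (∏ m ∈ Finset.range M,
        (Real.Gamma ((N : ℝ) - m + s) / Real.Gamma ((N : ℝ) - m))) := by
  induction M generalizing s with
  | zero => simp
  | succ M ih =>
    -- Any exponent in `(-1, 0)` would do. The vectors are thus almost surely independent, so their
    -- orthogonal complement has dimension exactly `N - M`.
    have hpos := ae_det_gram_re_pos_of_lintegral_ne_top (s := -1 / 2)
      (μ := Measure.pi fun _ : Fin M => isotropicGaussian (EuclideanSpace ℂ (Fin N))) (by norm_num)
      (by rw [ih (by omega) (by norm_num)]; exact ENNReal.ofReal_ne_top)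
    have hMN' : M < N := hMN
    have hMNr : (M : ℝ) + 1 ≤ N := by exact_mod_cast hMN
    rw [← ((measurePreserving_piFinSuccAbove (fun _ : Fin (M + 1) =>
      isotropicGaussian (EuclideanSpace ℂ (Fin N))) 0).symm).lintegral_comp (measurable_det_gram_re.ennreal_ofReal.pow_const s)]
    rw [lintegral_prod_symm _ (Measurable.aemeasurable ?_)]
    swap
    · exact (measurable_det_gram_re.ennreal_ofReal.pow_const s).comp (MeasurableEquiv.measurable _)
    rw [Finset.prod_range_succ, ENNReal.ofReal_mul, ← ih (by omega) hs, ← lintegral_mul_const _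
      (measurable_det_gram_re.ennreal_ofReal.pow_const s)]
    · refine lintegral_congr_ae ?_
      filter_upwards [hpos] with v hv
      have hli : LinearIndependent ℂ v := Matrix.linearIndependent_of_det_gram_ne_zero
        (𝕜 := ℂ) (fun h => by simp [h] at hv)
      have hdim : Module.finrank ℂ (Submodule.span ℂ (Set.range v))ᗮ = N - M := by
        have h1 := (Submodule.span ℂ (Set.range v)).finrank_add_finrank_orthogonal
        rw [finrank_span_eq_card hli, Fintype.card_fin, finrank_euclideanSpace_fin] at h1
        omega
      have hcast : ((N - M : ℕ) : ℝ) = N - M := Nat.cast_sub (by omega)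
      rw [← hcast, ← lintegral_norm_sq_orthogonalProjection_rpow _ hdim (by omega)
        (by rw [hcast]; linarith), ← lintegral_const_mul _ (by fun_prop)]
      refine lintegral_congr fun z => ?_
      have : (MeasurableEquiv.piFinSuccAbove (fun _ => EuclideanSpace ℂ (Fin N))
          (0 : Fin (M + 1))).symm (z, v) =
          (Fin.cons z v : Fin (M + 1) → EuclideanSpace ℂ (Fin N)) := by
        simp [MeasurableEquiv.piFinSuccAbove_symm_apply]
        rfl
      rw [this, det_gram_cons, Complex.re_ofReal_mul, ENNReal.ofReal_mul (by positivity),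
        ENNReal.mul_rpow_of_ne_top ENNReal.ofReal_ne_top ENNReal.ofReal_ne_top, mul_comm]
    · refine Finset.prod_nonneg fun m hm => ?_
      have : (m : ℝ) + 1 ≤ M := by exact_mod_cast Finset.mem_range.1 hm
      exact div_nonneg (Real.Gamma_nonneg_of_nonneg (by linarith))
        (Real.Gamma_nonneg_of_nonneg (by linarith))

end GramMoments

/-! ### Derivatives of `log Γ`. -/

section Gamma

theorem Real.analyticAt_Gamma {x : ℝ} (hx : 0 < x) : AnalyticAt ℝ Real.Gamma x := by
  have hc : AnalyticAt ℂ Complex.Gamma (x : ℂ) := by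
    refine DifferentiableOn.analyticAt (s := {z : ℂ | 0 < z.re}) (fun z hz => ?_)
      ((isOpen_lt continuous_const Complex.continuous_re).mem_nhds (by simpa using hx))
    refine (Complex.differentiableAt_Gamma z fun m h => ?_).differentiableWithinAt
    rw [h] at hz
    have hz' : (0 : ℝ) < (-(m : ℂ)).re := hz
    simp at hz'
    linarith [(Nat.cast_nonneg m : (0 : ℝ) ≤ m)]
  have h := (Complex.reCLM.analyticAt _).comp (hc.restrictScalars (𝕜 := ℝ) |>.comp_of_eq
    (Complex.ofRealCLM.analyticAt x) rfl)
  refine h.congr (.of_forall fun y => ?_)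
  simp [Complex.Gamma_ofReal]

theorem Real.analyticAt_log_Gamma_const_add {c : ℝ} (hc : 0 < c) :
    AnalyticAt ℝ (fun s => Real.log (Real.Gamma (c + s))) 0 := by
  refine AnalyticAt.log ?_ (by simpa using Real.Gamma_pos_of_pos hc)
  exact (Real.analyticAt_Gamma hc).comp_of_eq (by fun_prop) (by simp)

theorem Complex.digamma_ofReal {x : ℝ} (hx : 0 < x) :
    Complex.digamma x = (deriv Real.Gamma x / Real.Gamma x : ℝ) := by
  have hne : ∀ m : ℕ, (x : ℂ) ≠ -m := fun m h => by
    have : x = -(m : ℝ) := by exact_mod_cast h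
    linarith [(Nat.cast_nonneg m : (0 : ℝ) ≤ m)]
  have h1 := (Complex.differentiableAt_Gamma x hne).hasDerivAt.comp_ofReal
  have h2 := (Real.analyticAt_Gamma hx).differentiableAt.hasDerivAt.ofReal_comp
  simp only [Complex.Gamma_ofReal] at h1
  rw [Complex.digamma_def, logDeriv_apply, h1.unique h2, Complex.Gamma_ofReal]
  push_cast; rfl

theorem Real.deriv_log_Gamma_const_add {c : ℝ} (hc : 0 < c) :
    deriv (fun s => Real.log (Real.Gamma (c + s))) 0 = deriv Real.Gamma c / Real.Gamma c := by
  have h : HasDerivAt (fun s => Real.Gamma (c + s)) (deriv Real.Gamma c) 0 := by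
    have := (Real.analyticAt_Gamma hc).differentiableAt.hasDerivAt
    exact HasDerivAt.comp_const_add c 0 (by simpa using this)
  have := h.log (by simpa using (Real.Gamma_pos_of_pos hc).ne')
  simpa using this.deriv

/-- The reflection formula, cleared of denominators. -/
theorem Real.Gamma_one_add_mul_Gamma_one_sub_mul_sin {s : ℝ} (hs : |s| < 1) :
    Real.Gamma (1 + s) * Real.Gamma (1 - s) * Real.sin (Real.pi * s) = Real.pi * s := by
  rcases eq_or_ne s 0 with rfl | h0
  · simp
  obtain ⟨h1, h2⟩ := abs_lt.1 hs
  have hsin : Real.sin (Real.pi * s) ≠ 0 := by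
    intro h
    obtain ⟨n, hn⟩ := Real.sin_eq_zero_iff.1 h
    have hns : (n : ℝ) = s := by
      exact mul_right_cancel₀ Real.pi_pos.ne' (by linarith)
    rw [← hns] at h1 h2 h0
    have h1' : -1 < n := by exact_mod_cast h1
    have h2' : n < 1 := by exact_mod_cast h2
    exact h0 (by exact_mod_cast (by omega : n = 0))
  rw [add_comm 1 s, Real.Gamma_add_one h0, mul_assoc s, Real.Gamma_mul_Gamma_one_sub, mul_assoc s,
    div_mul_cancel₀ _ hsin, mul_comm]

/-- The even function `h s = log Γ(1+s) + log Γ(1-s)` satisfies `exp (h s) * sin (π s) = π s`, an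
identity that needs no division at `0`. Three differentiations there give `3 h''(0) = π²`, while
`h''(0)` is twice the wanted value. -/
theorem Real.iteratedDeriv_two_log_Gamma_one_add :
    iteratedDeriv 2 (fun s => Real.log (Real.Gamma (1 + s))) 0 = Real.pi ^ 2 / 6 := by
  set g : ℝ → ℝ := fun s => Real.log (Real.Gamma (1 + s))
  have hg : AnalyticAt ℝ g 0 := Real.analyticAt_log_Gamma_const_add one_pos
  set h : ℝ → ℝ := fun s => g s + g (-s)
  have hg' : AnalyticAt ℝ (fun s => g (-s)) 0 := by
    exact AnalyticAt.comp_of_eq (g := g) (f := fun s : ℝ => -s) (x := 0) (y := 0) hg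
      (by fun_prop) (by simp)
  have hh : AnalyticAt ℝ h 0 := hg.add hg'
  have hh2 : iteratedDeriv 2 h 0 = 2 * iteratedDeriv 2 g 0 := by
    rw [show h = g + fun s => g (-s) from rfl, iteratedDeriv_add hg.contDiffAt hg'.contDiffAt,
      iteratedDeriv_comp_neg]
    simp; ring
  have hh1 : deriv h 0 = 0 := by
    rw [show h = g + fun s => g (-s) from rfl, deriv_add hg.differentiableAt hg'.differentiableAt,
      deriv_comp_neg]
    simp
  have h0 : h 0 = 0 := by simp [h, g]
  have hexp : ∀ᶠ s in nhds (0 : ℝ), Real.exp (h s) * Real.sin (Real.pi * s) = Real.pi * s := by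
    filter_upwards [Metric.ball_mem_nhds (0 : ℝ) one_pos] with s hs
    have hs' : |s| < 1 := by simpa using hs
    obtain ⟨h1, h2⟩ := abs_lt.1 hs'
    refine Eq.trans ?_ (Real.Gamma_one_add_mul_Gamma_one_sub_mul_sin hs')
    rw [Real.exp_add,
      Real.exp_log (Real.Gamma_pos_of_pos (by linarith)),
      Real.exp_log (Real.Gamma_pos_of_pos (by linarith)), ← sub_eq_add_neg]
  have hd1 : ∀ᶠ s in nhds (0 : ℝ),
      Real.exp (h s) * (deriv h s * Real.sin (Real.pi * s) +
        Real.pi * Real.cos (Real.pi * s)) = Real.pi := by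
    filter_upwards [hexp.eventually_nhds, hh.eventually_analyticAt] with s hs has
    have hder := has.differentiableAt.hasDerivAt.exp.mul
      ((Real.hasDerivAt_sin (Real.pi * s)).comp s ((hasDerivAt_id s).const_mul Real.pi))
    have := hder.unique (((hasDerivAt_id s).const_mul Real.pi).congr_of_eventuallyEq hs)
    simp only [Function.comp] at this
    linarith
  have hd2 : ∀ᶠ s in nhds (0 : ℝ),
      deriv h s * (deriv h s * Real.sin (Real.pi * s) + Real.pi * Real.cos (Real.pi * s)) +
        (deriv (deriv h) s * Real.sin (Real.pi * s) +
          Real.pi * deriv h s * Real.cos (Real.pi * s)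
          - Real.pi ^ 2 * Real.sin (Real.pi * s)) = 0 := by
    filter_upwards [hd1.eventually_nhds, hh.eventually_analyticAt] with s hs has
    have hsin := (Real.hasDerivAt_sin (Real.pi * s)).comp s ((hasDerivAt_id s).const_mul Real.pi)
    have hcos := (Real.hasDerivAt_cos (Real.pi * s)).comp s ((hasDerivAt_id s).const_mul Real.pi)
    have hder := has.differentiableAt.hasDerivAt.exp.mul
      ((has.deriv.differentiableAt.hasDerivAt.mul hsin).add (hcos.const_mul Real.pi))
    have := hder.unique ((hasDerivAt_const s Real.pi).congr_of_eventuallyEq hs)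
    have hne := (Real.exp_pos (h s)).ne'
    apply mul_left_cancel₀ hne
    simp only [Function.comp, Pi.mul_apply, Pi.add_apply] at this
    linear_combination this
  have hsin := (Real.hasDerivAt_sin (Real.pi * 0)).comp 0
      ((hasDerivAt_id (0 : ℝ)).const_mul Real.pi)
  have hcos := (Real.hasDerivAt_cos (Real.pi * 0)).comp 0
      ((hasDerivAt_id (0 : ℝ)).const_mul Real.pi)
  have h1 := hh.deriv.differentiableAt.hasDerivAt
  have h2 := hh.deriv.deriv.differentiableAt.hasDerivAt
  have hd3 := (h1.mul ((h1.mul hsin).add (hcos.const_mul Real.pi))).add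
      (((h2.mul hsin).add ((h1.const_mul (Real.pi)).mul hcos)).sub
        (hsin.const_mul (Real.pi ^ 2)))
  have hfin := hd3.unique ((hasDerivAt_const (0 : ℝ) (0 : ℝ)).congr_of_eventuallyEq hd2)
  rw [iteratedDeriv_succ, iteratedDeriv_one] at hh2
  simp [hh1] at hfin
  have hpi := Real.pi_pos
  have : Real.pi * (3 * deriv (deriv h) 0 - Real.pi ^ 2) = 0 := by linear_combination hfin
  have := (mul_eq_zero.1 this).resolve_left hpi.ne'
  linarith

/-- Passing from `n` to `n + 1` adds `log (n + s)`, whose second derivative `-1 / n²` removes the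
leading term of the series. -/
theorem Real.iteratedDeriv_two_log_Gamma_natCast_add {n : ℕ} (hn : 1 ≤ n) :
    iteratedDeriv 2 (fun s => Real.log (Real.Gamma (n + s))) 0 = hurwitzZetaSeries 2 n := by
  have hsum : ∀ n : ℕ, 1 ≤ n → Summable fun k : ℕ => 1 / ((n : ℝ) + k) ^ (2 : ℝ) := by
    intro n hn
    have := (summable_nat_add_iff n).2 (Real.summable_one_div_nat_pow.2 (by norm_num : 1 < 2))
    refine this.congr fun k => ?_
    push_cast
    norm_cast
    rw [add_comm]
  induction n, hn using Nat.le_induction with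
  | base =>
    rw [Nat.cast_one, Real.iteratedDeriv_two_log_Gamma_one_add, hurwitzZetaSeries]
    have := hasSum_zeta_two
    rw [← hasSum_nat_add_iff' 1] at this
    simp only [Finset.range_one, Finset.sum_singleton] at this
    -- The term of index `0` is `1 / 0 = 0`, so dropping it leaves the sum unchanged.
    have hval : Real.pi ^ 2 / 6 - 1 / ((0 : ℕ) : ℝ) ^ 2 = Real.pi ^ 2 / 6 := by simp
    rw [hval] at this
    rw [← this.tsum_eq]
    refine tsum_congr fun k => ?_
    push_cast
    norm_cast
    rw [add_comm]
  | succ n hn ih =>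
    have hn0 : (0 : ℝ) < n := by exact_mod_cast hn
    have heq : (fun s => Real.log (Real.Gamma ((n + 1 : ℕ) + s))) =ᶠ[nhds 0]
        ((fun s => Real.log (n + s)) + fun s => Real.log (Real.Gamma (n + s))) := by
      filter_upwards [lt_mem_nhds (show -(n : ℝ) < 0 by linarith)] with s hs
      have hpos : 0 < (n : ℝ) + s := by linarith
      rw [Pi.add_apply, ← Real.log_mul hpos.ne' (Real.Gamma_pos_of_pos hpos).ne',
        ← Real.Gamma_add_one hpos.ne']
      congr 2; push_cast; ring
    have hlog : AnalyticAt ℝ (fun s => Real.log ((n : ℝ) + s)) 0 :=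
      AnalyticAt.log (by fun_prop) (by simpa using hn0)
    have hl2 : iteratedDeriv 2 (fun s => Real.log ((n : ℝ) + s)) 0 = -(1 / (n : ℝ) ^ 2) := by
      rw [iteratedDeriv_comp_const_add 2 Real.log (n : ℝ), iteratedDeriv_succ, iteratedDeriv_one,
        Real.deriv_log']
      simp
    rw [heq.iteratedDeriv_eq 2, iteratedDeriv_add hlog.contDiffAt
      (Real.analyticAt_log_Gamma_const_add hn0).contDiffAt, ih, hl2, hurwitzZetaSeries,
      hurwitzZetaSeries, (hsum n hn).tsum_eq_zero_add]
    have : ∀ k : ℕ, ((n : ℝ) + (k + 1 : ℕ)) = ((n + 1 : ℕ) : ℝ) + k := fun k => by push_cast; ring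
    simp_rw [this]
    norm_num

end Gamma

/-! ### The law of the whitened matrix. -/

section Law

variable {Ω : Type*} [MeasurableSpace Ω] {μ : Measure Ω} [IsProbabilityMeasure μ]

theorem IsCircularComplexGaussian.integral_exp_re_dotProduct {M : ℕ} {x : Ω → Fin M → ℂ}
    {S : Matrix (Fin M) (Fin M) ℂ} (hx : IsCircularComplexGaussian x S μ) (c : Fin M → ℂ) :
    ∫ ω, Complex.exp ((c ⬝ᵥ x ω).re * Complex.I) ∂μ =
      Complex.exp (-((c ⬝ᵥ S *ᵥ star c).re / 4 : ℝ)) := by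
  have hG := hx.hasGaussianLaw
  have hmem : ∀ i, MemLp (fun ω => x ω i) 2 μ := fun i => (hG.eval i).memLp_two
  have hmemc : ∀ i, MemLp (fun ω => conj (x ω i)) 2 μ := fun i => (hmem i).star
  let L : (Fin M → ℂ) →L[ℝ] ℝ :=
    Complex.reCLM ∘L ∑ i, (c i) • (ContinuousLinearMap.proj i : (Fin M → ℂ) →L[ℝ] ℂ)
  have hL : ∀ v, L v = (c ⬝ᵥ v).re := fun v => by
    simp [L, dotProduct]
  have hch := hG.charFunDual_map_eq_fun L
  rw [charFunDual_apply, integral_map hG.aemeasurable (by fun_prop)] at hch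
  simp only [hL] at hch
  rw [hch]
  have hint : Integrable (fun ω => c ⬝ᵥ x ω) μ := by
    simp only [dotProduct]
    exact integrable_finsetSum _ fun i _ => ((hmem i).integrable (by norm_num)).const_mul _
  have hmean : ∫ ω, (c ⬝ᵥ x ω).re ∂μ = 0 := by
    have h1 : ∫ ω, c ⬝ᵥ x ω ∂μ = 0 := by
      simp only [dotProduct]
      rw [integral_finsetSum _ fun i _ => ((hmem i).integrable (by norm_num)).const_mul _]
      simp [integral_const_mul, hx.mean_eq_zero]
    have h2 := Complex.reCLM.integral_comp_comm hint
    simp only [Complex.reCLM_apply, h1] at h2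
    simpa using h2
  -- This is `(Re z)² = Re (|z|² + z²) / 2`; the vanishing pseudo-covariance kills the `z²` part in
  -- expectation, which leaves half the Hermitian form.
  have hsq : ∀ ω, (c ⬝ᵥ x ω).re ^ 2 =
      (∑ i, ∑ j, (c i * conj (c j) * (x ω i * conj (x ω j)) +
        c i * c j * (x ω i * x ω j))).re / 2 := by
    intro ω
    have : (∑ i, ∑ j, (c i * conj (c j) * (x ω i * conj (x ω j)) +
        c i * c j * (x ω i * x ω j))) = (c ⬝ᵥ x ω) * conj (c ⬝ᵥ x ω) +
          (c ⬝ᵥ x ω) * (c ⬝ᵥ x ω) := by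
      simp only [dotProduct, map_sum, map_mul, Finset.sum_mul_sum, ← Finset.sum_add_distrib]
      exact Finset.sum_congr rfl fun i _ => Finset.sum_congr rfl fun j _ => by ring
    rw [this]
    simp
    ring
  have hxc : ∀ i j, Integrable (fun ω => c i * conj (c j) * (x ω i * conj (x ω j))) μ :=
    fun i j => ((hmem i).integrable_mul (hmemc j)).const_mul _
  have hxx : ∀ i j, Integrable (fun ω => c i * c j * (x ω i * x ω j)) μ :=
    fun i j => ((hmem i).integrable_mul (hmem j)).const_mul _
  have hint2 : ∀ i j, Integrable (fun ω => c i * conj (c j) * (x ω i * conj (x ω j)) +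
        c i * c j * (x ω i * x ω j)) μ := fun i j => (hxc i j).add (hxx i j)
  have hsum : ∫ ω, (∑ i, ∑ j, (c i * conj (c j) * (x ω i * conj (x ω j)) +
        c i * c j * (x ω i * x ω j))) ∂μ = c ⬝ᵥ S *ᵥ star c := by
    rw [integral_finsetSum _ fun i _ => integrable_finsetSum _ fun j _ => hint2 i j]
    simp only [dotProduct, Matrix.mulVec, Finset.mul_sum]
    refine Finset.sum_congr rfl fun i _ => ?_
    rw [integral_finsetSum _ fun j _ => hint2 i j]
    refine Finset.sum_congr rfl fun j _ => ?_
    rw [integral_add (hxc i j) (hxx i j), integral_const_mul, integral_const_mul,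
      hx.covariance_eq, hx.pseudoCovariance_eq_zero]
    simp
    ring
  have hvar : Var[fun ω => (c ⬝ᵥ x ω).re; μ] = (c ⬝ᵥ S *ᵥ star c).re / 2 := by
    rw [variance_of_integral_eq_zero (X := fun ω => (c ⬝ᵥ x ω).re)
      (Complex.measurable_re.comp_aemeasurable hint.aemeasurable)
      hmean]
    simp only [hsq]
    rw [integral_div]
    have h2 := Complex.reCLM.integral_comp_comm
      (integrable_finsetSum Finset.univ fun i _ =>
        integrable_finsetSum Finset.univ fun j _ => hint2 i j)
    simp only [Complex.reCLM_apply, hsum] at h2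
    rw [h2]
  rw [hmean, hvar]
  congr 1
  push_cast
  ring

/-- Column independence factors the characteristic function, and whitening turns its exponent into
`-∑ ‖t m n‖² / 4`. Regrouping this double sum by rows exchanges independence of columns for
independence of rows. -/
theorem map_rows_mul_eq_pi_isotropicGaussian {M N : ℕ} {S B : Matrix (Fin M) (Fin M) ℂ}
    (hB : B * S * Bᴴ = 1) {X : Ω → Matrix (Fin M) (Fin N) ℂ}
    (hGauss : ∀ n : Fin N, IsCircularComplexGaussian (fun ω m => X ω m n) S μ)
    (hIndep : iIndepFun (fun (n : Fin N) (ω : Ω) (m : Fin M) => X ω m n) μ) :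
    AEMeasurable (fun ω m => WithLp.toLp 2 ((B * X ω) m)) μ ∧
    μ.map (fun ω m => WithLp.toLp 2 ((B * X ω) m)) =
      Measure.pi fun _ : Fin M => isotropicGaussian (EuclideanSpace ℂ (Fin N)) := by
  have hmeas : ∀ m n, AEMeasurable (fun ω => X ω m n) μ := fun m n =>
    ((hGauss n).hasGaussianLaw.eval m).aemeasurable
  have hR : AEMeasurable (fun ω m => WithLp.toLp 2 ((B * X ω) m)) μ := by
    refine aemeasurable_pi_lambda _ fun m => ?_
    refine (WithLp.measurable_toLp 2 _).comp_aemeasurable (aemeasurable_pi_lambda _ fun n => ?_)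
    simp only [Matrix.mul_apply]
    exact Finset.aemeasurable_fun_sum _ fun j _ => (hmeas j n).const_mul _
  refine ⟨hR, ?_⟩
  have : IsProbabilityMeasure (μ.map (fun ω m => WithLp.toLp 2 ((B * X ω) m))) :=
    Measure.isProbabilityMeasure_map hR
  refine charFun_eq_pi_iff.1 fun t => ?_
  rw [charFun_apply, integral_map (by fun_prop) (by fun_prop), integral_map hR (by fun_prop)]
  -- The conjugate appears because the real inner product with `t` is the real part of `∑ conj t *
  -- y`.
  let u : Fin N → Fin M → ℂ := fun n m => conj (t m n)
  have hinner : ∀ ω, inner ℝ (WithLp.toLp 2 fun m => WithLp.toLp 2 ((B * X ω) m)) t =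
      ∑ n, ((u n ᵥ* B) ⬝ᵥ fun m => X ω m n).re := by
    intro ω
    simp only [← Matrix.dotProduct_mulVec]
    simp only [PiLp.inner_apply, Complex.inner, dotProduct, Complex.re_sum]
    rw [Finset.sum_comm]
    refine Finset.sum_congr rfl fun n _ => Finset.sum_congr rfl fun m _ => ?_
    have : (B *ᵥ fun m => X ω m n) m = (B * X ω) m n := rfl
    rw [this]
    simp [u]
  simp only [hinner, Complex.ofReal_sum, Finset.sum_mul, Complex.exp_sum]
  rw [hIndep.integral_fun_prod_comp
    (f := fun n v => Complex.exp (((u n ᵥ* B) ⬝ᵥ v).re * Complex.I))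
    (fun n => (hGauss n).hasGaussianLaw.aemeasurable)
    (fun n => Continuous.aestronglyMeasurable (by simp only [dotProduct]; fun_prop))]
  simp only [fun n => (hGauss n).integral_exp_re_dotProduct, charFun_isotropicGaussian]
  rw [← Complex.exp_sum, ← Complex.exp_sum]
  congr 1
  have hQ : ∀ n, ((u n ᵥ* B) ⬝ᵥ S *ᵥ star (u n ᵥ* B)).re = ∑ m, ‖t m n‖ ^ 2 := by
    intro n
    rw [Matrix.star_vecMul, ← Matrix.dotProduct_mulVec, Matrix.mulVec_mulVec, Matrix.mulVec_mulVec,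
      hB, Matrix.one_mulVec]
    simp only [dotProduct, Complex.re_sum]
    refine Finset.sum_congr rfl fun m _ => ?_
    simp [u, ← Complex.normSq_eq_norm_sq, Complex.normSq_apply]
  simp only [hQ, EuclideanSpace.norm_sq_eq]
  simp only [Finset.sum_neg_distrib, ← Complex.ofReal_sum, ← Finset.sum_div]
  rw [Finset.sum_comm]

end Law

/-! ### Whitening and the moment generating function of the log-determinant. -/

section LogDet

open scoped MatrixOrder Matrix.Norms.L2Operator in
theorem Matrix.PosDef.exists_whitening {M : ℕ} {S : Matrix (Fin M) (Fin M) ℂ} (hS : S.PosDef) :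
    ∃ B : Matrix (Fin M) (Fin M) ℂ, B * S * Bᴴ = 1 := by
  obtain ⟨C, hC, rfl⟩ := CStarAlgebra.isStrictlyPositive_iff_eq_star_mul_self.mp
    hS.isStrictlyPositive
  obtain ⟨u, rfl⟩ := hC
  -- With `S = uᴴ u` and `u` invertible, the inverse adjoint of `u` whitens `S`.
  refine ⟨((u⁻¹ : (Matrix (Fin M) (Fin M) ℂ)ˣ) : Matrix (Fin M) (Fin M) ℂ)ᴴ, ?_⟩
  rw [Matrix.conjTranspose_conjTranspose, Matrix.star_eq_conjTranspose, ← Matrix.mul_assoc,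
    ← Matrix.conjTranspose_mul, Units.mul_inv, Matrix.conjTranspose_one, Matrix.one_mul,
    Units.mul_inv]

theorem mul_conjTranspose_eq_transpose_gram {M N : ℕ} (A : Matrix (Fin M) (Fin N) ℂ) :
    A * Aᴴ = (Matrix.gram ℂ fun m => WithLp.toLp 2 (A m))ᵀ := by
  ext i j
  simp [Matrix.mul_apply, PiLp.inner_apply]

theorem det_mul_conjTranspose_of_whitening {M N : ℕ} {S B : Matrix (Fin M) (Fin M) ℂ}
    (hB : B * S * Bᴴ = 1) (A : Matrix (Fin M) (Fin N) ℂ) :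
    (A * Aᴴ).det = S.det * (Matrix.gram ℂ fun m => WithLp.toLp 2 ((B * A) m)).det := by
  have h1 : B.det * S.det * Bᴴ.det = 1 := by
    rw [← Matrix.det_mul, ← Matrix.det_mul, hB, Matrix.det_one]
  rw [← Matrix.det_transpose (Matrix.gram ℂ _), ← mul_conjTranspose_eq_transpose_gram,
    Matrix.conjTranspose_mul, Matrix.mul_assoc, ← Matrix.mul_assoc A, Matrix.det_mul,
    Matrix.det_mul]
  linear_combination -(A * Aᴴ).det * h1

theorem moment_logDetGram {Ω : Type*} [MeasurableSpace Ω] {μ : Measure Ω} [IsProbabilityMeasure μ]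
    {M N : ℕ} (hMN : M ≤ N) {S : Matrix (Fin M) (Fin M) ℂ} (hS : S.PosDef)
    {X : Ω → Matrix (Fin M) (Fin N) ℂ}
    (hGauss : ∀ n : Fin N, IsCircularComplexGaussian (fun ω m => X ω m n) S μ)
    (hIndep : iIndepFun (fun (n : Fin N) (ω : Ω) (m : Fin M) => X ω m n) μ) :
    (∀ᵐ ω ∂μ, 0 < (X ω * (X ω)ᴴ).det) ∧
    ∀ s : ℝ, -1 < s → Integrable (fun ω => Real.exp (s * logDetGram (X ω))) μ ∧
      mgf (fun ω => logDetGram (X ω)) μ s = S.det.re ^ s * ∏ m ∈ Finset.range M,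
        (Real.Gamma ((N : ℝ) - m + s) / Real.Gamma ((N : ℝ) - m)) := by
  obtain ⟨B, hB⟩ := hS.exists_whitening
  obtain ⟨hR, hlaw⟩ := map_rows_mul_eq_pi_isotropicGaussian hB hGauss hIndep
  set R : Ω → Fin M → EuclideanSpace ℂ (Fin N) := fun ω m => WithLp.toLp 2 ((B * X ω) m) with hRdef
  have hmom : ∀ s : ℝ, -1 < s → ∫⁻ ω, ENNReal.ofReal (Matrix.gram ℂ (R ω)).det.re ^ s ∂μ =
      ENNReal.ofReal (∏ m ∈ Finset.range M,
        (Real.Gamma ((N : ℝ) - m + s) / Real.Gamma ((N : ℝ) - m))) := by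
    intro s hs
    rw [← lintegral_det_gram_rpow N M hMN hs, ← hlaw, lintegral_map'
      (measurable_det_gram_re.ennreal_ofReal.pow_const s).aemeasurable hR]
  have hpos : ∀ᵐ ω ∂μ, 0 < (Matrix.gram ℂ (R ω)).det.re := by
    refine ae_of_ae_map hR (p := fun v => 0 < (Matrix.gram ℂ v).det.re) ?_
    rw [hlaw]
    refine ae_det_gram_re_pos_of_lintegral_ne_top (s := -1 / 2) (by norm_num) ?_
    rw [lintegral_det_gram_rpow N M hMN (by norm_num)]
    exact ENNReal.ofReal_ne_top
  have hSdet : 0 < S.det := hS.det_pos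
  have hSre : 0 < S.det.re := (Complex.lt_def.1 hSdet).1
  have hSofReal : S.det = (S.det.re : ℂ) := (Complex.eq_re_of_ofReal_le hSdet.le)
  have hdet : ∀ ω, (X ω * (X ω)ᴴ).det = S.det * (Matrix.gram ℂ (R ω)).det :=
    fun ω => det_mul_conjTranspose_of_whitening hB (X ω)
  have hre : ∀ ω, (X ω * (X ω)ᴴ).det.re = S.det.re * (Matrix.gram ℂ (R ω)).det.re := fun ω => by
    rw [hdet, hSofReal, Complex.re_ofReal_mul, Complex.ofReal_re]
  refine ⟨?_, fun s hs => ?_⟩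
  · filter_upwards [hpos] with ω hω
    rw [hdet]
    -- Positivity in ℂ includes being real: positive semidefiniteness gives nonnegativity, and the
    -- positive real part excludes zero.
    refine mul_pos hSdet (lt_of_le_of_ne (Matrix.posSemidef_gram ℂ (R ω)).det_nonneg ?_)
    intro h
    rw [← h] at hω
    exact lt_irrefl _ hω
  have hmeasD : AEMeasurable (fun ω => (Matrix.gram ℂ (R ω)).det.re) μ :=
    measurable_det_gram_re.comp_aemeasurable hR
  have hmeas : AEMeasurable (fun ω => Real.exp (s * logDetGram (X ω))) μ := by
    simp only [logDetGram, hre]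
    exact ((Real.measurable_log.comp_aemeasurable (hmeasD.const_mul _)).const_mul _).exp
  have hprod : 0 ≤ ∏ m ∈ Finset.range M,
      (Real.Gamma ((N : ℝ) - m + s) / Real.Gamma ((N : ℝ) - m)) := by
    refine Finset.prod_nonneg fun m hm => ?_
    have h1 : (m : ℝ) + 1 ≤ M := by exact_mod_cast Finset.mem_range.1 hm
    have h2 : (M : ℝ) ≤ N := by exact_mod_cast hMN
    exact div_nonneg (Real.Gamma_nonneg_of_nonneg (by linarith))
      (Real.Gamma_nonneg_of_nonneg (by linarith))
  have hl : ∫⁻ ω, ENNReal.ofReal (Real.exp (s * logDetGram (X ω))) ∂μ =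
      ENNReal.ofReal (S.det.re ^ s * ∏ m ∈ Finset.range M,
        (Real.Gamma ((N : ℝ) - m + s) / Real.Gamma ((N : ℝ) - m))) := by
    rw [ENNReal.ofReal_mul (by positivity), ← hmom s hs,
      ← lintegral_const_mul' _ _ ENNReal.ofReal_ne_top]
    refine lintegral_congr_ae ?_
    filter_upwards [hpos] with ω hω
    rw [ENNReal.ofReal_rpow_of_pos hω, ← ENNReal.ofReal_mul (by positivity),
      ← Real.mul_rpow hSre.le hω.le, Real.rpow_def_of_pos (mul_pos hSre hω), logDetGram, hre,
      mul_comm s]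
  constructor
  · rw [← lintegral_ofReal_ne_top_iff_integrable hmeas.aestronglyMeasurable
      (.of_forall fun ω => (Real.exp_pos _).le), hl]
    exact ENNReal.ofReal_ne_top
  · rw [mgf, integral_eq_lintegral_of_nonneg_ae (.of_forall fun ω => (Real.exp_pos _).le)
      hmeas.aestronglyMeasurable, hl, ENNReal.toReal_ofReal (by positivity)]

end LogDet

/-! ### Mean and variance from the cumulant generating function. -/

theorem mainTheorem6 {Ω : Type*} [MeasurableSpace Ω] (μ : Measure Ω) [IsProbabilityMeasure μ]
    (M N : ℕ) (hMN : M ≤ N)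
    (S : Matrix (Fin M) (Fin M) ℂ) (hS : S.PosDef)
    (X : Ω → Matrix (Fin M) (Fin N) ℂ)
    (hGauss : ∀ n : Fin N, IsCircularComplexGaussian (fun ω m => X ω m n) S μ)
    (hIndep : iIndepFun (fun (n : Fin N) (ω : Ω) (m : Fin M) => X ω m n) μ) :
    (∀ᵐ ω ∂μ, 0 < (X ω * (X ω)ᴴ).det) ∧
    MemLp (fun ω => logDetGram (X ω)) 2 μ ∧
    ((∫ ω, logDetGram (X ω) ∂μ : ℝ) : ℂ) =
      ∑ m ∈ Finset.range M, Complex.digamma ((N : ℂ) - (m : ℂ)) + (Real.log S.det.re : ℂ) ∧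
    variance (fun ω => logDetGram (X ω)) μ =
      ∑ m ∈ Finset.range M, hurwitzZetaSeries 2 ((N : ℝ) - (m : ℝ)) := by
  obtain ⟨hpos, hmom⟩ := moment_logDetGram hMN hS hGauss hIndep
  have hSre : 0 < S.det.re := (Complex.lt_def.1 hS.det_pos).1
  have hlt : ∀ m ∈ Finset.range M, 0 < (N : ℝ) - m ∧ 1 ≤ (N : ℝ) - m ∧
      ((N - m : ℕ) : ℝ) = N - m ∧ 1 ≤ N - m := fun m hm => by
    have h1 : m < M := Finset.mem_range.1 hm
    have h3 : ((N - m : ℕ) : ℝ) = N - m := Nat.cast_sub (by omega)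
    have h4 : 1 ≤ N - m := by omega
    have h5 : (1 : ℝ) ≤ ((N - m : ℕ) : ℝ) := by exact_mod_cast h4
    exact ⟨by linarith, by linarith, h3, h4⟩
  -- Exponential moments on both sides of `0` give square integrability and justify differentiating
  -- the cumulant generating function there.
  have hint : (0 : ℝ) ∈ interior (integrableExpSet (fun ω => logDetGram (X ω)) μ) := by
    rw [mem_interior_iff_mem_nhds]
    filter_upwards [lt_mem_nhds (show (-1 : ℝ) < 0 by norm_num)] with s hs using (hmom s hs).1
  have hterm : ∀ m ∈ Finset.range M, AnalyticAt ℝ (fun s => Real.log (Real.Gamma ((N : ℝ) - m + s))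
      - Real.log (Real.Gamma ((N : ℝ) - m))) 0 := fun m hm =>
    (Real.analyticAt_log_Gamma_const_add (hlt m hm).1).sub analyticAt_const
  have hlin : AnalyticAt ℝ (fun s => s * Real.log S.det.re) 0 := by fun_prop
  have hcgf : cgf (fun ω => logDetGram (X ω)) μ =ᶠ[nhds 0]
      (fun s => s * Real.log S.det.re) + fun s => ∑ m ∈ Finset.range M,
        (Real.log (Real.Gamma ((N : ℝ) - m + s)) - Real.log (Real.Gamma ((N : ℝ) - m))) := by
    filter_upwards [lt_mem_nhds (show (-1 : ℝ) < 0 by norm_num)] with s hs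
    have hG : ∀ m ∈ Finset.range M, Real.Gamma ((N : ℝ) - m + s) ≠ 0 ∧
        Real.Gamma ((N : ℝ) - m) ≠ 0 := fun m hm => by
      obtain ⟨h1, h2, -⟩ := hlt m hm
      exact ⟨(Real.Gamma_pos_of_pos (by linarith)).ne', (Real.Gamma_pos_of_pos h1).ne'⟩
    rw [cgf, (hmom s hs).2, Real.log_mul (by positivity) (Finset.prod_ne_zero_iff.2 fun m hm =>
      div_ne_zero (hG m hm).1 (hG m hm).2), Real.log_rpow hSre, Real.log_prod
      fun m hm => div_ne_zero (hG m hm).1 (hG m hm).2, Pi.add_apply]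
    congr 1
    exact Finset.sum_congr rfl fun m hm => Real.log_div (hG m hm).1 (hG m hm).2
  have hsumA : AnalyticAt ℝ (fun s => ∑ m ∈ Finset.range M,
      (Real.log (Real.Gamma ((N : ℝ) - m + s)) - Real.log (Real.Gamma ((N : ℝ) - m)))) 0 :=
    Finset.analyticAt_fun_sum _ hterm
  refine ⟨hpos, memLp_of_mem_interior_integrableExpSet hint 2, ?_, ?_⟩
  · have hmean := deriv_cgf_zero hint
    rw [probReal_univ, div_one, hcgf.deriv_eq, deriv_add hlin.differentiableAt
      hsumA.differentiableAt, deriv_fun_sum fun m hm => (hterm m hm).differentiableAt] at hmean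
    rw [← hmean, add_comm]
    push_cast
    congr 1
    · refine Finset.sum_congr rfl fun m hm => ?_
      have hc : ((N : ℂ) - m) = (((N : ℝ) - m : ℝ) : ℂ) := by push_cast; rfl
      rw [deriv_sub_const_fun, Real.deriv_log_Gamma_const_add (hlt m hm).1, hc,
        Complex.digamma_ofReal (hlt m hm).1]
    · simp
  · have hvar := variance_tilted_mul hint
    simp only [zero_mul, tilted_const] at hvar
    rw [hvar, hcgf.iteratedDeriv_eq, iteratedDeriv_add hlin.contDiffAt hsumA.contDiffAt,
      iteratedDeriv_fun_sum fun m hm => (hterm m hm).contDiffAt]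
    have h0 : iteratedDeriv 2 (fun s : ℝ => s * Real.log S.det.re) 0 = 0 := by
      rw [iteratedDeriv_succ, iteratedDeriv_one]
      simp
    rw [h0, zero_add]
    refine Finset.sum_congr rfl fun m hm => ?_
    obtain ⟨h1, -, h3, h4⟩ := hlt m hm
    -- Peeling off one derivative on each side makes the constant `log Γ(N - m)` disappear.
    rw [← h3, ← Real.iteratedDeriv_two_log_Gamma_natCast_add h4, iteratedDeriv_succ',
      iteratedDeriv_succ' (f := fun s => Real.log (Real.Gamma ((N - m : ℕ) + s)))]
    congr 1
    funext s
    rw [deriv_sub_const_fun]
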